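/- Let $\mathcal{E}$ be an elementary topos (a category with finite limits, exponentials and a subobject classifier). Let $\mathbb{I}$ be an interval object in $\mathcal{E}$: an object with a monomorphism $[\partial_0,\partial_1]\colon 1+1\to\mathbb{I}$ (write $0,1$ for the two endpoints) and maps $\wedge,\vee\colon\mathbb{I}\times\mathbb{I}\to\mathbb{I}$ satisfying $i\wedge 0=0\wedge i=0$, $i\wedge 1=1\wedge i=i$, $i\vee 0=0\vee i=i$, $i\vee 1=1\vee i=1$. Let $\mathcal{C}$ be a class of monomorphisms of $\mathcal{E}$ (the cofibrations) such that (a) $\mathcal{C}$ is a dominance: it contains all isomorphisms, is closed under composition and under pullback, and the category whose objects are the elements of $\mathcal{C}$ and whose morphisms are the pullback squares between them has a terminal object; (b) subobjects represented by elements of $\mathcal{C}$ are closed under finite unions (including the empty union); (c) $[\partial_0,\partial_1]\in\mathcal{C}$. For $u\colon X\to Y$ and $i\in\{0,1\}$ let $\partial_i\hat\otimes u\colon (\mathbb{I}\times X)\cup_{1\times X}(1\times Y)\to\mathbb{I}\times Y$ be the pushout product. A map is a fibration if it has the right lifting property with respect to all $\partial_i\hat\otimes u$ with $u\in\mathcal{C}$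 and $i\in\{0,1\}$; an object $X$ is fibrant if $X\to 1$ is a fibration, and $\mathcal{E}_f$ is the full subcategory of fibrant objects. For an object $A$ let $(\mathcal{E}/A)_f$ be the full subcategory of $\mathcal{E}/A$ on the fibrations with codomain $A$. Let $f\colon B\to A$ be a fibration. Then the pullback functor $f^*\colon\mathcal{E}/A\to\mathcal{E}/B$ has a right adjoint, and every right adjoint $\Pi_f\colon\mathcal{E}/B\to\mathcal{E}/A$ of $f^*$ preserves fibrations: if $g\colon C\to B$ is a fibration, then so is $\Pi_f(g)$; and if $h$ is a morphism of $\mathcal{E}/B$ whose underlying map in $\mathcal{E}$ is a fibration, then the underlying map of $\Pi_f(h)$ is a fibration. Consequently $\Pi$-types along fibrations can be interpreted in $\mathcal{E}_f$, in the following sense: $f^*$ and $\Pi_f$ restrict to an adjunction $f^*\colon(\mathcal{E}/A)_f\rightleftarrows(\mathcal{E}/B)_f\colon\Pi_f$, and if $A$ is fibrant and $g\colon C\to B$ is a fibration, then the domain of $\Pi_f(g)$ is fibrant. -/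

import Mathlib

open CategoryTheory CategoryTheory.Limits MonoidalCategory CartesianMonoidalCategory

universe v u

/-! Throughout, an elementary topos is a category `E` with finite limits (with chosen finite
products, `CartesianMonoidalCategory E`), exponentials (`MonoidalClosed E`) and a subobject
classifier (`HasSubobjectClassifier E`). Finite colimits exist in every such category; they are
not assumed, and coproducts, pushouts and unions are referred to by their universal properties. -/

/-- An interval object: an object `I` with a monomorphism `[∂₀, ∂₁] : 1 + 1 ⟶ I` and two
connections `∧, ∨ : I × I ⟶ I`. The equations are stated for generalized elements of `I`. -/
structure IntervalObject (E : Type u) [Category.{v} E] [CartesianMonoidalCategory E] where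
  /-- The interval. -/
  I : E
  /-- The coproduct `1 + 1`. -/
  two : BinaryCofan (𝟙_ E) (𝟙_ E)
  isColimitTwo : IsColimit two
  /-- The map `[∂₀, ∂₁] : 1 + 1 ⟶ I`. -/
  endpoints : two.pt ⟶ I
  mono_endpoints : Mono endpoints
  /-- The connection `∧`. -/
  meet : I ⊗ I ⟶ I
  /-- The connection `∨`. -/
  join : I ⊗ I ⟶ I
  meet_zero : ∀ {X : E} (i : X ⟶ I),
    lift i (toUnit X ≫ two.inl ≫ endpoints) ≫ meet = toUnit X ≫ two.inl ≫ endpoints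
  zero_meet : ∀ {X : E} (i : X ⟶ I),
    lift (toUnit X ≫ two.inl ≫ endpoints) i ≫ meet = toUnit X ≫ two.inl ≫ endpoints
  meet_one : ∀ {X : E} (i : X ⟶ I), lift i (toUnit X ≫ two.inr ≫ endpoints) ≫ meet = i
  one_meet : ∀ {X : E} (i : X ⟶ I), lift (toUnit X ≫ two.inr ≫ endpoints) i ≫ meet = i
  join_zero : ∀ {X : E} (i : X ⟶ I), lift i (toUnit X ≫ two.inl ≫ endpoints) ≫ join = i
  zero_join : ∀ {X : E} (i : X ⟶ I), lift (toUnit X ≫ two.inl ≫ endpoints) i ≫ join = i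
  join_one : ∀ {X : E} (i : X ⟶ I),
    lift i (toUnit X ≫ two.inr ≫ endpoints) ≫ join = toUnit X ≫ two.inr ≫ endpoints
  one_join : ∀ {X : E} (i : X ⟶ I),
    lift (toUnit X ≫ two.inr ≫ endpoints) i ≫ join = toUnit X ≫ two.inr ≫ endpoints

namespace IntervalObject

variable {E : Type u} [Category.{v} E] [CartesianMonoidalCategory E]

/-- The endpoint inclusion `∂₀ : 1 ⟶ I`. -/
def zero (𝕀 : IntervalObject E) : 𝟙_ E ⟶ 𝕀.I := 𝕀.two.inl ≫ 𝕀.endpoints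

/-- The endpoint inclusion `∂₁ : 1 ⟶ I`. -/
def one (𝕀 : IntervalObject E) : 𝟙_ E ⟶ 𝕀.I := 𝕀.two.inr ≫ 𝕀.endpoints

end IntervalObject

/-- A dominance: a class of monomorphisms containing the isomorphisms, closed under composition
and under pullback, such that the category whose objects are the members of the class and whose
morphisms are the pullback squares between them has a terminal object `t`. -/
structure IsDominance {E : Type u} [Category.{v} E] (S : MorphismProperty E) : Prop where
  mono : ∀ {X Y : E} (m : X ⟶ Y), S m → Mono m
  of_isIso : ∀ {X Y : E} (m : X ⟶ Y), IsIso m → S m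
  comp : ∀ {X Y Z : E} (m : X ⟶ Y) (n : Y ⟶ Z), S m → S n → S (m ≫ n)
  of_isPullback : ∀ {X' Y' X Y : E} {a : X' ⟶ X} {m' : X' ⟶ Y'} {m : X ⟶ Y} {b : Y' ⟶ Y},
    IsPullback a m' m b → S m → S m'
  exists_terminal : ∃ (T U : E) (t : T ⟶ U), S t ∧
    ∀ {X Y : E} (m : X ⟶ Y), S m →
      ∃! p : (X ⟶ T) × (Y ⟶ U), IsPullback p.1 m t p.2

/-- A class of cofibrations: a dominance which is closed under finite unions of subobjects
(unions being least upper bounds in the poset of subobjects, the empty union being the least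
subobject) and which contains `[∂₀, ∂₁] : 1 + 1 ⟶ I`. -/
structure IsCofibrationClass {E : Type u} [Category.{v} E] [CartesianMonoidalCategory E]
    (𝕀 : IntervalObject E) (Cof : MorphismProperty E) : Prop where
  isDominance : IsDominance Cof
  empty_union : ∀ X : E, ∃ P : Subobject X, Cof P.arrow ∧ IsBot P
  binary_union : ∀ {X : E} (P Q : Subobject X), Cof P.arrow → Cof Q.arrow →
    ∃ R : Subobject X, Cof R.arrow ∧ IsLUB {P, Q} R
  endpoints : Cof 𝕀.endpoints

section Fibrations

variable {E : Type u} [Category.{v} E] [CartesianMonoidalCategory E]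

/-- A fibration: a map with the right lifting property against all Leibniz (pushout) products
`∂₀ ⊗̂ u` and `∂₁ ⊗̂ u` with `u` a cofibration. Here `sq` ranges over the pushouts of
`1 × Y ⟵ 1 × X ⟶ I × X`, and `sq.ι` is the induced map from the pushout to `I × Y`. -/
def IsFib (𝕀 : IntervalObject E) (Cof : MorphismProperty E) {C D : E} (p : C ⟶ D) : Prop :=
  ∀ {X Y : E} (u : X ⟶ Y), Cof u →
    (∀ sq : (curriedTensor E).PushoutObjObj 𝕀.zero u, HasLiftingProperty sq.ι p) ∧
    (∀ sq : (curriedTensor E).PushoutObjObj 𝕀.one u, HasLiftingProperty sq.ι p)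

/-- An object is fibrant if its map to the terminal object is a fibration. -/
def IsFibrantObj (𝕀 : IntervalObject E) (Cof : MorphismProperty E) (X : E) : Prop :=
  IsFib 𝕀 Cof (toUnit X)

/-- The objects of the slice `E/A` which are fibrations over `A`. -/
def fibrationsOver (𝕀 : IntervalObject E) (Cof : MorphismProperty E) (A : E) :
    ObjectProperty (Over A) :=
  fun X => IsFib 𝕀 Cof X.hom

/-- The full subcategory `(E/A)_f` of `E/A` on the fibrations over `A`. -/
abbrev FibOver (𝕀 : IntervalObject E) (Cof : MorphismProperty E) (A : E) :=
  (fibrationsOver 𝕀 Cof A).FullSubcategory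

/-- The restriction `(E/A)_f ⥤ (E/B)_f` of a functor `E/A ⥤ E/B` which sends fibrations over `A`
to fibrations over `B`. -/
def restrictFib (𝕀 : IntervalObject E) (Cof : MorphismProperty E) {A B : E}
    (F : Over A ⥤ Over B)
    (hF : ∀ X : Over A, IsFib 𝕀 Cof X.hom → IsFib 𝕀 Cof (F.obj X).hom) :
    FibOver 𝕀 Cof A ⥤ FibOver 𝕀 Cof B :=
  (fibrationsOver 𝕀 Cof B).lift ((fibrationsOver 𝕀 Cof A).ι ⋙ F)
    (fun X => hF X.obj X.property)

end Fibrations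

/-! The heart is the Frobenius property: a pullback of `∂ₑ ⊗̂ u` along a fibration still lifts
against fibrations. By the adjunction, a lifting problem of `j` against `Π_f(h)` is a lifting
problem of `f^* j` against `h`, and `f^* j` is the pullback of `j` along a base change of `f`
(`hasLiftingProperty_map_left`).

Write `e'` for the other endpoint. The connection absorbing at `e` contracts `I × Y` onto its end
`e`. This homotopy is the identity at `e'`, lands in the domain of `∂ₑ ⊗̂ u` at `e`, and preserves
that domain throughout: a `Deformation`. Path lifting from `e'` transports it along a fibration
(`Deformation.exists_of_isPullback`). Conversely, a cofibration with a deformation lifts against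
every fibration: fill a box open opposite `e` and read the filler at `e'`
(`Deformation.hasLiftingProperty`).

This needs `∂ₑ ⊗̂ u` to be a cofibration. It is the inclusion of the union of `I × X` and `e × Y`,
because unions in a topos are pushouts over the intersection (`isPushout_of_cover`), and each single
endpoint is a cofibration. The existence of `Π_f` comes from partial map classifiers. -/

noncomputable section Topos

/-! ### Generalized elements and the subobject classifier. -/

namespace CategoryTheory.HasSubobjectClassifier

variable {E : Type u} [Category.{v} E] [HasSubobjectClassifier E]

/-- The constant map `X ⟶ Ω` with value `true`. -/
def constTrue (X : E) : X ⟶ Ω E := Subobject.Classifier.χ₀ _ X ≫ truth E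

lemma comp_constTrue {X Y : E} (f : X ⟶ Y) : f ≫ constTrue Y = constTrue X := by
  rw [constTrue, constTrue, ← Category.assoc]
  congr 1
  exact Subsingleton.elim _ _

/-- Membership in a subobject, tested on generalized elements; this allows the later arguments about
subsets to be carried out elementwise. -/
lemma comp_χ_eq_constTrue_iff {U X T : E} (m : U ⟶ X) [Mono m] (x : T ⟶ X) :
    x ≫ χ m = constTrue T ↔ ∃ y : T ⟶ U, y ≫ m = x := by
  constructor
  · intro h
    exact ⟨(isPullback_χ m).lift x _ h, (isPullback_χ m).lift_fst _ _ _⟩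
  · rintro ⟨y, rfl⟩
    rw [Category.assoc, comm, ← constTrue, comp_constTrue]

lemma eq_χ_of_forall_iff {U X : E} (m : U ⟶ X) [Mono m] (a : X ⟶ Ω E)
    (h : ∀ {T : E} (x : T ⟶ X), x ≫ a = constTrue T ↔ ∃ y : T ⟶ U, y ≫ m = x) : a = χ m := by
  have key (s : PullbackCone a (truth E)) : ∃ y, y ≫ m = s.fst := by
    rw [← h, s.condition, constTrue]
    congr 1
    exact Subsingleton.elim _ _
  refine unique m a ⟨⟨(h m).2 ⟨𝟙 _, Category.id_comp _⟩⟩,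
    ⟨PullbackCone.IsLimit.mk _ (fun s => (key s).choose) (fun s => (key s).choose_spec)
      (fun s => Subsingleton.elim _ _) fun s l hl _ => ?_⟩⟩
  rw [← cancel_mono m, hl, (key s).choose_spec]

/-- Two maps to `Ω` are equal if they are true at the same generalized elements. -/
lemma hom_ext_Ω [HasPullbacks E] {X : E} {a b : X ⟶ Ω E}
    (h : ∀ {T : E} (x : T ⟶ X), x ≫ a = constTrue T ↔ x ≫ b = constTrue T) : a = b := by
  obtain ⟨Z, i, hi, hb⟩ := Subobject.Classifier.surjective_χ _ b
  replace hb : b = χ i := hb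
  rw [hb]
  refine eq_χ_of_forall_iff i a fun x => ?_
  rw [h, hb, comp_χ_eq_constTrue_iff]

lemma comp_χ_of_isPullback {U X U' X' : E} {a : U' ⟶ U} {m' : U' ⟶ X'} {m : U ⟶ X} {b : X' ⟶ X}
    [Mono m] [Mono m'] (h : IsPullback a m' m b) : b ≫ χ m = χ m' := by
  refine eq_χ_of_forall_iff _ _ fun {T} x => ?_
  rw [← Category.assoc, comp_χ_eq_constTrue_iff]
  constructor
  · rintro ⟨y, hy⟩
    exact ⟨h.lift y x hy, h.lift_snd _ _ _⟩
  · rintro ⟨y, rfl⟩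
    exact ⟨y ≫ a, by rw [Category.assoc, h.w, Category.assoc]⟩

end CategoryTheory.HasSubobjectClassifier

open HasSubobjectClassifier

namespace CategoryTheory

lemma isPullback_comp_mono_iff {E : Type u} [Category.{v} E] {P X Y Z W : E} {a : P ⟶ X}
    {b : P ⟶ Y} {f : X ⟶ Z} {g : Y ⟶ Z} (i : Z ⟶ W) [Mono i] :
    IsPullback a b (f ≫ i) (g ≫ i) ↔ IsPullback a b f g := by
  constructor
  · intro h
    have w : a ≫ f = b ≫ g := by simpa [← cancel_mono i] using h.w
    exact ⟨⟨w⟩, ⟨PullbackCone.IsLimit.mk _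
      (fun s => h.lift s.fst s.snd (by rw [reassoc_of% s.condition]))
      (fun s => h.lift_fst _ _ _) (fun s => h.lift_snd _ _ _)
      (fun s m h1 h2 => h.hom_ext (by rw [h1, h.lift_fst]) (by rw [h2, h.lift_snd]))⟩⟩
  · intro h
    exact ⟨⟨by rw [reassoc_of% h.w]⟩, ⟨PullbackCone.IsLimit.mk _
      (fun s => h.lift s.fst s.snd (by simpa [← cancel_mono i] using s.condition))
      (fun s => h.lift_fst _ _ _) (fun s => h.lift_snd _ _ _)
      (fun s m h1 h2 => h.hom_ext (by rw [h1, h.lift_fst]) (by rw [h2, h.lift_snd]))⟩⟩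

/-! ### Power objects and partial map classifiers. -/

section PartialMaps

variable {E : Type u} [Category.{v} E] [CartesianMonoidalCategory E]

instance mono_lift_right {U X Y : E} (f : U ⟶ X) (g : U ⟶ Y) [Mono g] : Mono (lift f g) :=
  mono_of_mono_fac (lift_snd f g)

variable [MonoidalClosed E] [HasSubobjectClassifier E]

/-- The map `Z ⟶ Ω ^ C` which sends `z` to `{g u | m u = z}`. -/
def partialMapGraph {U Z C : E} (m : U ⟶ Z) [Mono m] (g : U ⟶ C) : Z ⟶ (ihom C).obj (Ω E) :=
  MonoidalClosed.curry (χ (lift g m))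

/-- Membership of a generalized element of `C` in a generalized subset of `C`. -/
def Mem {T C : E} (c : T ⟶ C) (S : T ⟶ (ihom C).obj (Ω E)) : Prop :=
  lift c S ≫ (ihom.ev C).app (Ω E) = constTrue T

lemma mem_comp_iff {T Z C : E} (c : T ⟶ C) (z : T ⟶ Z) (S : Z ⟶ (ihom C).obj (Ω E)) :
    Mem c (z ≫ S) ↔ lift c z ≫ MonoidalClosed.uncurry S = constTrue T := by
  rw [Mem, MonoidalClosed.uncurry_eq, ← Category.assoc, lift_whiskerLeft]

lemma mem_partialMapGraph {U Z C T : E} (m : U ⟶ Z) [Mono m] (g : U ⟶ C) (c : T ⟶ C)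
    (z : T ⟶ Z) : Mem c (z ≫ partialMapGraph m g) ↔ ∃ y : T ⟶ U, y ≫ g = c ∧ y ≫ m = z := by
  rw [mem_comp_iff, partialMapGraph, MonoidalClosed.uncurry_curry, comp_χ_eq_constTrue_iff]
  refine exists_congr fun y => ?_
  rw [comp_lift]
  constructor
  · intro h
    exact ⟨by simpa using h =≫ fst _ _, by simpa using h =≫ snd _ _⟩
  · rintro ⟨rfl, rfl⟩
    rfl

/-- The singleton map `C ⟶ Ω ^ C`. -/
def singleton (C : E) : C ⟶ (ihom C).obj (Ω E) := partialMapGraph (𝟙 C) (𝟙 C)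

lemma mem_singleton {T C : E} (c c' : T ⟶ C) : Mem c (c' ≫ singleton C) ↔ c = c' := by
  rw [singleton, mem_partialMapGraph]
  simp

instance mono_singleton (C : E) : Mono (singleton C) where
  right_cancellation a b h := by
    rw [← mem_singleton, ← h, mem_singleton]

variable [HasFiniteLimits E]

/-- Extensionality for generalized subsets. -/
lemma powerObject_hom_ext {Z C : E} {S S' : Z ⟶ (ihom C).obj (Ω E)}
    (h : ∀ {T : E} (c : T ⟶ C) (z : T ⟶ Z), Mem c (z ≫ S) ↔ Mem c (z ≫ S')) : S = S' := by
  apply MonoidalClosed.uncurry_injective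
  refine hom_ext_Ω fun {T} x => ?_
  have hx : x = lift (x ≫ fst _ _) (x ≫ snd _ _) := by
    rw [← comp_lift, lift_fst_snd, Category.comp_id]
  rw [hx, ← mem_comp_iff, ← mem_comp_iff, h]

lemma isPullback_partialMapGraph {U Z C : E} (m : U ⟶ Z) [Mono m] (g : U ⟶ C) :
    IsPullback g m (singleton C) (partialMapGraph m g) := by
  have w : g ≫ singleton C = m ≫ partialMapGraph m g := by
    refine powerObject_hom_ext fun c z => ?_
    rw [← Category.assoc, ← Category.assoc, mem_singleton, mem_partialMapGraph]
    constructor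
    · intro h
      exact ⟨z, h.symm, rfl⟩
    · rintro ⟨y, h, h'⟩
      rw [cancel_mono] at h'
      rw [← h, h']
  have key (s : PullbackCone (singleton C) (partialMapGraph m g)) :
      ∃ y : s.pt ⟶ U, y ≫ g = s.fst ∧ y ≫ m = s.snd := by
    rw [← mem_partialMapGraph, ← s.condition, mem_singleton]
  refine ⟨⟨w⟩, ⟨PullbackCone.IsLimit.mk _ (fun s => (key s).choose)
    (fun s => (key s).choose_spec.1) (fun s => (key s).choose_spec.2) ?_⟩⟩
  intro s l _ hl
  rw [← cancel_mono m, hl, (key s).choose_spec.2]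

lemma comp_partialMapGraph {U Z U' Z' C : E} {m : U ⟶ Z} [Mono m] {m' : U' ⟶ Z'} [Mono m']
    {a : U' ⟶ U} {z : Z' ⟶ Z} (h : IsPullback a m' m z) (g : U ⟶ C) :
    z ≫ partialMapGraph m g = partialMapGraph m' (a ≫ g) := by
  refine powerObject_hom_ext fun c y => ?_
  rw [← Category.assoc, mem_partialMapGraph, mem_partialMapGraph]
  constructor
  · rintro ⟨x, h1, h2⟩
    exact ⟨h.lift x y h2, by rw [h.lift_fst_assoc, h1], h.lift_snd _ _ _⟩
  · rintro ⟨x, h1, h2⟩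
    exact ⟨x ≫ a, by rw [Category.assoc, h1], by rw [Category.assoc, h.w, reassoc_of% h2]⟩

/-- Partial map classifiers exist in a topos. -/
theorem exists_partialMapClassifier (C : E) :
    ∃ (C' : E) (η : C ⟶ C'), Mono η ∧ ∀ {U Z : E} (m : U ⟶ Z) [Mono m] (g : U ⟶ C),
      ∃! χ : Z ⟶ C', IsPullback g m η χ := by
  -- `e` sends a subset `S` to `{c | {c} = S}`. Its fixed points are the subsets with at most one
  -- element, and they form the classifier.
  let e := partialMapGraph (singleton C) (𝟙 C)
  have he {U Z : E} {m : U ⟶ Z} [Mono m] {g : U ⟶ C} {t : Z ⟶ (ihom C).obj (Ω E)}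
      (h : IsPullback g m (singleton C) t) : t ≫ e = partialMapGraph m g := by
    rw [comp_partialMapGraph h, Category.comp_id]
  have hs : singleton C ≫ e = singleton C ≫ 𝟙 _ := by
    rw [Category.comp_id]
    exact he (isPullback_partialMapGraph (𝟙 C) (𝟙 C))
  have hη : equalizer.lift (singleton C) hs ≫ equalizer.ι e (𝟙 _) = singleton C :=
    equalizer.lift_ι _ _
  refine ⟨equalizer e (𝟙 _), equalizer.lift (singleton C) hs, mono_of_mono_fac hη, ?_⟩
  intro U Z m _ g
  have hm : partialMapGraph m g ≫ e = partialMapGraph m g ≫ 𝟙 _ := by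
    rw [he (isPullback_partialMapGraph m g), Category.comp_id]
  refine ⟨equalizer.lift _ hm, ?_, ?_⟩
  · beta_reduce
    rw [← isPullback_comp_mono_iff (equalizer.ι e (𝟙 _)), hη, equalizer.lift_ι]
    exact isPullback_partialMapGraph m g
  · intro χ hχ
    rw [← cancel_mono (equalizer.ι e (𝟙 _)), equalizer.lift_ι]
    rw [← isPullback_comp_mono_iff (equalizer.ι e (𝟙 _)), hη] at hχ
    rw [← he hχ, Category.assoc, equalizer.condition, Category.comp_id]

end PartialMaps

/-! ### Effectiveness of unions. -/

section EffectiveUnions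

variable {E : Type u} [Category.{v} E] [HasFiniteLimits E]

/-- Two maps which agree on a pair of subobjects whose union is everything are equal. -/
lemma hom_ext_of_cover {P Q R W : E} {p : P ⟶ R} {q : Q ⟶ R}
    (hcov : ∀ {N : E} (n : N ⟶ R) [Mono n], (∃ a, a ≫ n = p) → (∃ b, b ≫ n = q) → IsIso n)
    {a b : R ⟶ W} (hp : p ≫ a = p ≫ b) (hq : q ≫ a = q ≫ b) : a = b := by
  have := hcov (equalizer.ι a b) ⟨equalizer.lift p hp, equalizer.lift_ι _ _⟩
    ⟨equalizer.lift q hq, equalizer.lift_ι _ _⟩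
  rw [← cancel_epi (equalizer.ι a b), equalizer.condition]

variable [CartesianMonoidalCategory E] [MonoidalClosed E] [HasSubobjectClassifier E]

/-- Unions in a topos are effective: the union of two subobjects is their pushout over the
intersection. -/
theorem isPushout_of_cover {P Q R D : E} {p : P ⟶ R} {q : Q ⟶ R} [Mono p] [Mono q]
    {d₁ : D ⟶ P} {d₂ : D ⟶ Q} (hD : IsPullback d₁ d₂ p q)
    (hcov : ∀ {N : E} (n : N ⟶ R) [Mono n], (∃ a, a ≫ n = p) → (∃ b, b ≫ n = q) → IsIso n) :
    IsPushout d₁ d₂ p q := by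
  have key {W : E} (f : P ⟶ W) (g : Q ⟶ W) (hfg : d₁ ≫ f = d₂ ≫ g) :
      ∃ t : R ⟶ W, p ≫ t = f ∧ q ≫ t = g := by
    -- The glued map is first built as a relation: `t r` consists of the `w` such that `r ∈ P` iff
    -- `(w, r)` is in the graph of `f`, and `r ∈ Q` iff `(w, r)` is in the graph of `g`.
    let a : W ⊗ R ⟶ Ω E ⊗ Ω E := lift (snd _ _ ≫ χ p) (snd _ _ ≫ χ q)
    let b : W ⊗ R ⟶ Ω E ⊗ Ω E := lift (χ (lift f p)) (χ (lift g q))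
    let t : R ⟶ (ihom W).obj (Ω E) := MonoidalClosed.curry (χ (equalizer.ι a b))
    have hmem {T : E} (w : T ⟶ W) (r : T ⟶ R) : Mem w (r ≫ t) ↔
        r ≫ χ p = lift w r ≫ χ (lift f p) ∧ r ≫ χ q = lift w r ≫ χ (lift g q) := by
      rw [mem_comp_iff, MonoidalClosed.uncurry_curry, comp_χ_eq_constTrue_iff]
      have : (∃ y, y ≫ equalizer.ι a b = lift w r) ↔ lift w r ≫ a = lift w r ≫ b := by
        constructor
        · rintro ⟨y, hy⟩
          rw [← hy, Category.assoc, Category.assoc, equalizer.condition]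
        · intro h
          exact ⟨equalizer.lift _ h, equalizer.lift_ι _ _⟩
      rw [this, comp_lift, comp_lift, lift_snd_assoc, lift_snd_assoc]
      constructor
      · intro h
        exact ⟨by simpa using h =≫ fst _ _, by simpa using h =≫ snd _ _⟩
      · rintro ⟨h, h'⟩
        rw [h, h']
    have hfac {A T : E} (i : A ⟶ R) [Mono i] (h : A ⟶ W) (w : T ⟶ W) (r : T ⟶ R) :
        lift w r ≫ χ (lift h i) = constTrue T ↔ ∃ y : T ⟶ A, y ≫ h = w ∧ y ≫ i = r := by
      rw [← mem_partialMapGraph, mem_comp_iff, partialMapGraph, MonoidalClosed.uncurry_curry]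
    -- On one of the two pieces, the condition coming from the other holds automatically, since the
    -- two maps agree on the intersection.
    have hcross {A B : E} {i : A ⟶ R} {j : B ⟶ R} [Mono i] [Mono j] {k : D ⟶ A} {l : D ⟶ B}
        (hkl : IsPullback k l i j) {x : A ⟶ W} {y : B ⟶ W} (hxy : k ≫ x = l ≫ y)
        {T : E} (s : T ⟶ A) :
        (s ≫ i) ≫ χ j = lift (s ≫ x) (s ≫ i) ≫ χ (lift y j) := by
      refine hom_ext_Ω fun {T'} s' => ?_
      rw [← Category.assoc, comp_χ_eq_constTrue_iff, comp_lift_assoc, hfac]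
      constructor
      · rintro ⟨b, hb⟩
        have hb' : (s' ≫ s) ≫ i = b ≫ j := by simp [hb]
        refine ⟨b, ?_, hb⟩
        have h1 := hkl.lift_fst _ _ hb'
        have h2 := hkl.lift_snd _ _ hb'
        rw [← h2, Category.assoc, ← hxy, reassoc_of% h1]
      · rintro ⟨b, _, hb⟩
        exact ⟨b, hb⟩
    have hp : p ≫ t = f ≫ singleton W := by
      refine powerObject_hom_ext fun {T} w s => ?_
      rw [← Category.assoc, hmem, ← Category.assoc, mem_singleton]
      constructor
      · rintro ⟨h, -⟩
        rw [(comp_χ_eq_constTrue_iff p (s ≫ p)).2 ⟨s, rfl⟩, eq_comm, hfac] at h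
        obtain ⟨y, hy, hy'⟩ := h
        rw [← hy, (cancel_mono p).1 hy']
      · rintro rfl
        refine ⟨?_, hcross hD hfg s⟩
        rw [(comp_χ_eq_constTrue_iff p (s ≫ p)).2 ⟨s, rfl⟩, eq_comm, hfac]
        exact ⟨s, rfl, rfl⟩
    have hq : q ≫ t = g ≫ singleton W := by
      refine powerObject_hom_ext fun {T} w s => ?_
      rw [← Category.assoc, hmem, ← Category.assoc, mem_singleton]
      constructor
      · rintro ⟨-, h⟩
        rw [(comp_χ_eq_constTrue_iff q (s ≫ q)).2 ⟨s, rfl⟩, eq_comm, hfac] at h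
        obtain ⟨y, hy, hy'⟩ := h
        rw [← hy, (cancel_mono q).1 hy']
      · rintro rfl
        refine ⟨hcross hD.flip hfg.symm s, ?_⟩
        rw [(comp_χ_eq_constTrue_iff q (s ≫ q)).2 ⟨s, rfl⟩, eq_comm, hfac]
        exact ⟨s, rfl, rfl⟩
    -- The locus where `t r` is a singleton contains `P` and `Q`, hence is all of `R`.
    have := hcov (pullback.fst t (singleton W)) ⟨pullback.lift p f hp, pullback.lift_fst _ _ _⟩
      ⟨pullback.lift q g hq, pullback.lift_fst _ _ _⟩
    have ht : (inv (pullback.fst t (singleton W)) ≫ pullback.snd t (singleton W)) ≫ singleton W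
        = t := by
      rw [Category.assoc, ← pullback.condition, IsIso.inv_hom_id_assoc]
    refine ⟨inv (pullback.fst t (singleton W)) ≫ pullback.snd t (singleton W), ?_, ?_⟩
    · rw [← cancel_mono (singleton W), Category.assoc, ht, hp]
    · rw [← cancel_mono (singleton W), Category.assoc, ht, hq]
  refine ⟨⟨hD.w⟩, ⟨PushoutCocone.IsColimit.mk _
    (fun s => (key s.inl s.inr s.condition).choose)
    (fun s => (key s.inl s.inr s.condition).choose_spec.1)
    (fun s => (key s.inl s.inr s.condition).choose_spec.2) ?_⟩⟩
  intro s m h1 h2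
  refine hom_ext_of_cover hcov ?_ ?_
  · rw [h1, (key s.inl s.inr s.condition).choose_spec.1]
  · rw [h2, (key s.inl s.inr s.condition).choose_spec.2]

end EffectiveUnions

end CategoryTheory

end Topos

/-! ### Dependent products along an arbitrary map. -/

section Pushforward

namespace CategoryTheory

variable {E : Type u} [Category.{v} E] [HasFiniteLimits E] [CartesianMonoidalCategory E]

lemma isPullback_graph {X A B : E} (x : X ⟶ A) (f : B ⟶ A) :
    IsPullback (pullback.snd x f) (lift (pullback.snd x f) (pullback.fst x f))
      (lift (𝟙 B) f) (B ◁ x) := by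
  have key (s : PullbackCone (lift (𝟙 B) f) (B ◁ x)) :
      s.fst = s.snd ≫ fst _ _ ∧ (s.snd ≫ snd _ _) ≫ x = s.fst ≫ f :=
    ⟨by simpa using s.condition =≫ fst _ _, by simpa using (s.condition =≫ snd _ _).symm⟩
  refine ⟨⟨by ext <;> simp [pullback.condition]⟩, ⟨PullbackCone.IsLimit.mk _
    (fun s => pullback.lift (s.snd ≫ snd _ _) s.fst (key s).2)
    (fun s => pullback.lift_snd _ _ _) (fun s => ?_) (fun s m h1 h2 => ?_)⟩⟩
  · rw [comp_lift, pullback.lift_fst, pullback.lift_snd, (key s).1, ← comp_lift, lift_fst_snd,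
      Category.comp_id]
  · apply pullback.hom_ext
    · rw [pullback.lift_fst, ← h2, Category.assoc, lift_snd]
    · rw [pullback.lift_snd, h1]

lemma lift_snd_fst_pullback_map {X P A B : E} {x : X ⟶ A} {p : P ⟶ A} (f : B ⟶ A) (k : X ⟶ P)
    {l : pullback x f ⟶ pullback p f}
    (h₁ : l ≫ pullback.fst p f = pullback.fst x f ≫ k)
    (h₂ : l ≫ pullback.snd p f = pullback.snd x f) :
    l ≫ lift (pullback.snd p f) (pullback.fst p f) =
      lift (pullback.snd x f) (pullback.fst x f) ≫ B ◁ k := by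
  ext <;> simp [h₁, h₂]

variable [MonoidalClosed E] [HasSubobjectClassifier E]

/-- The universal property of the dependent product of `g : C ⟶ B` along `f : B ⟶ A`. -/
lemma exists_dependentProduct {A B C : E} (f : B ⟶ A) (g : C ⟶ B) :
    ∃ (P : E) (p : P ⟶ A) (ε : pullback p f ⟶ C), ε ≫ g = pullback.snd p f ∧
      ∀ {X : E} (x : X ⟶ A) (h : pullback x f ⟶ C), h ≫ g = pullback.snd x f →
        ∃! k : X ⟶ P, ∃ hk : k ≫ p = x,
          pullback.lift (pullback.fst x f ≫ k) (pullback.snd x f)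
            (by rw [Category.assoc, hk, pullback.condition]) ≫ ε = h := by
  -- With `B'`, `C'` classifying partial maps, the product is the pullback of `A ⟶ B'^B` and `C'^B ⟶
  -- B'^B`. The first map sends `a` to the identity of the fibre of `f` over `a`, as a partial map
  -- `B ⇀ B`; the second composes with `g`. A point over `a` is thus a section of `g` on that fibre.
  obtain ⟨B', ηB, _, hB⟩ := exists_partialMapClassifier B
  obtain ⟨C', ηC, _, hC⟩ := exists_partialMapClassifier C
  obtain ⟨g', hg', -⟩ := hB ηC g
  obtain ⟨φ, hφ, -⟩ := hB (lift (𝟙 B) f) (𝟙 B)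
  have hφ' {X : E} (x : X ⟶ A) : IsPullback (pullback.snd x f)
      (lift (pullback.snd x f) (pullback.fst x f)) ηB (B ◁ x ≫ φ) := by
    simpa using (isPullback_graph x f).paste_horiz hφ
  let a : A ⟶ (ihom B).obj B' := MonoidalClosed.curry φ
  let b : (ihom B).obj C' ⟶ (ihom B).obj B' := (ihom B).map g'
  let ψ : B ⊗ pullback a b ⟶ C' := MonoidalClosed.uncurry (pullback.snd a b)
  have hψ : ψ ≫ g' = B ◁ pullback.fst a b ≫ φ := by
    rw [← MonoidalClosed.uncurry_natural_right, ← pullback.condition,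
      MonoidalClosed.uncurry_natural_left, MonoidalClosed.uncurry_curry]
  let i {X : E} (x : X ⟶ A) : pullback x f ⟶ B ⊗ X := lift (pullback.snd x f) (pullback.fst x f)
  have hi {X : E} (x : X ⟶ A) : Mono (i x) := ⟨fun s t h => by
    apply pullback.hom_ext
    · simpa [i] using h =≫ snd _ _
    · simpa [i] using h =≫ fst _ _⟩
  have hε : pullback.snd (pullback.fst a b) f ≫ ηB = (i (pullback.fst a b) ≫ ψ) ≫ g' := by
    rw [Category.assoc, hψ, (hφ' _).w]
  refine ⟨pullback a b, pullback.fst a b, hg'.lift _ _ hε, hg'.lift_fst _ _ _, ?_⟩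
  intro X x h hh
  obtain ⟨ψh, hψh, hu⟩ := hC (i x) h
  have hψg : ψh ≫ g' = B ◁ x ≫ φ :=
    (hB (i x) (pullback.snd x f)).unique (by simpa [hh] using hψh.paste_horiz hg') (hφ' x)
  have hψk {k : X ⟶ pullback a b} : B ◁ k ≫ ψ = MonoidalClosed.uncurry (k ≫ pullback.snd a b) :=
    (MonoidalClosed.uncurry_natural_left _ _).symm
  have hεη : hg'.lift _ _ hε ≫ ηC = i (pullback.fst a b) ≫ ψ := hg'.lift_snd _ _ _
  have hw : x ≫ a = MonoidalClosed.curry ψh ≫ b := by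
    rw [← MonoidalClosed.curry_natural_left, ← MonoidalClosed.curry_natural_right, hψg]
  refine ⟨pullback.lift x (MonoidalClosed.curry ψh) hw, ⟨pullback.lift_fst _ _ _, ?_⟩, ?_⟩
  · rw [← cancel_mono ηC, Category.assoc, hεη, ← Category.assoc,
      lift_snd_fst_pullback_map f _ (pullback.lift_fst _ _ _) (pullback.lift_snd _ _ _),
      Category.assoc, hψk, pullback.lift_snd, MonoidalClosed.uncurry_curry, ← hψh.w]
  · rintro k ⟨hk, hkε⟩
    apply pullback.hom_ext
    · rw [hk, pullback.lift_fst]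
    · rw [pullback.lift_snd, MonoidalClosed.eq_curry_iff, ← hψk]
      have hg : (B ◁ k ≫ ψ) ≫ g' = B ◁ x ≫ φ := by
        rw [Category.assoc, hψ, ← MonoidalCategory.whiskerLeft_comp_assoc, hk]
      -- The domain of the partial map given by `k` is read off after composing with `g'`: the outer
      -- and right squares are pullbacks, hence so is the left one.
      refine hu _ (IsPullback.of_right (h₁₂ := g) (h₂₂ := g') ?_ ?_ hg')
      · rw [hh, hg]
        exact hφ' x
      · rw [← hkε, Category.assoc, hεη]
        simpa only [Category.assoc] using lift_snd_fst_pullback_map f k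
          (pullback.lift_fst _ _ (by rw [Category.assoc, hk, pullback.condition]))
          (pullback.lift_snd _ _ _) =≫ ψ

/-- In a topos, pullback functors between slices have right adjoints. -/
theorem isLeftAdjoint_overPullback {A B : E} (f : B ⟶ A) :
    (Over.pullback f).IsLeftAdjoint := by
  have (Y : Over B) : HasTerminal (CostructuredArrow (Over.pullback f) Y) := by
    obtain ⟨P, p, ε, hε, hu⟩ := exists_dependentProduct f Y.hom
    let e : (Over.pullback f).obj (Over.mk p) ⟶ Y := Over.homMk ε hε
    choose k hk hk' using fun Z : CostructuredArrow (Over.pullback f) Y =>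
      hu Z.left.hom Z.hom.left (Over.w Z.hom)
    refine (IsTerminal.ofUniqueHom (Y := CostructuredArrow.mk e)
      (fun Z => CostructuredArrow.homMk (Over.homMk (k Z) (hk Z).choose) ?_)
      (fun Z m => ?_)).hasTerminal
    · ext
      exact (hk Z).choose_spec
    · ext
      refine hk' Z _ ⟨Over.w m.left, ?_⟩
      exact congrArg CommaMorphism.left (CostructuredArrow.w m)
  exact isLeftAdjoint_of_costructuredArrowTerminals _

end CategoryTheory

end Pushforward

/-! ### Endpoints and pushout products are cofibrations. -/

section Cofibrations

open HasSubobjectClassifier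

/-- The equalizer of `a` and `b` is a subobject of `X` below `P`, hence all of `P`. -/
lemma hom_ext_of_isBot {E : Type u} [Category.{v} E] [HasEqualizers E] {X W : E} {P : Subobject X}
    (hP : IsBot P) (a b : (P : E) ⟶ W) : a = b := by
  have h := hP (Subobject.mk (equalizer.ι a b ≫ P.arrow))
  have hs : Subobject.ofLEMk P _ h ≫ equalizer.ι a b = 𝟙 _ := by
    rw [← cancel_mono P.arrow, Category.assoc, Subobject.ofLEMk_comp, Category.id_comp]
  rw [← Category.id_comp a, ← hs, Category.assoc, equalizer.condition, reassoc_of% hs]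

variable {E : Type u} [Category.{v} E] [CartesianMonoidalCategory E]

lemma isPullback_whiskerLeft_snd (A : E) {X Y : E} (u : X ⟶ Y) :
    IsPullback (snd A X) (A ◁ u) u (snd A Y) := by
  refine ⟨⟨by simp⟩, ⟨PullbackCone.IsLimit.mk _ (fun s => lift (s.snd ≫ fst _ _) s.fst)
    (fun s => by simp) (fun s => ?_) (fun s m h1 h2 => ?_)⟩⟩
  · ext <;> simp [s.condition]
  · ext
    · simp [← h2]
    · simpa using h1

lemma isPullback_whiskerRight_fst (A : E) {X Y : E} (u : X ⟶ Y) :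
    IsPullback (fst X A) (u ▷ A) u (fst Y A) := by
  refine ⟨⟨by simp⟩, ⟨PullbackCone.IsLimit.mk _ (fun s => lift s.fst (s.snd ≫ snd _ _))
    (fun s => by simp) (fun s => ?_) (fun s m h1 h2 => ?_)⟩⟩
  · ext <;> simp [s.condition]
  · ext
    · simpa using h1
    · simp [← h2]

lemma isPullback_whiskerRight_whiskerLeft {A A' X Y : E} (e : A ⟶ A') (u : X ⟶ Y) :
    IsPullback (e ▷ X) (A ◁ u) (A' ◁ u) (e ▷ Y) := by
  refine IsPullback.of_right ?_ (whisker_exchange e u).symm (isPullback_whiskerLeft_snd A' u)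
  rw [whiskerRight_snd, whiskerRight_snd]
  exact isPullback_whiskerLeft_snd A u

variable [HasFiniteLimits E] [HasSubobjectClassifier E] {𝕀 : IntervalObject E}
  {Cof : MorphismProperty E}

namespace IsCofibrationClass

/-- The classifying maps of the full and the empty subobject of `1` glue to a map on `1 + 1`;
pulling back the generic cofibration along it gives the first summand. -/
lemma of_isColimit_inl (hCof : IsCofibrationClass 𝕀 Cof) {S : E} {i j : 𝟙_ E ⟶ S}
    (hc : IsColimit (BinaryCofan.mk i j)) : Cof i := by
  have hd := hCof.isDominance
  obtain ⟨P, hP, hbot⟩ := hCof.empty_union (𝟙_ E)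
  obtain ⟨T, U, t, ht, hcl⟩ := hd.exists_terminal
  obtain ⟨⟨a, b⟩, (hab : IsPullback a (𝟙 _) t b), -⟩ := hcl (𝟙 (𝟙_ E)) (hd.of_isIso _ inferInstance)
  obtain ⟨⟨a', b'⟩, (hab' : IsPullback a' P.arrow t b'), -⟩ := hcl P.arrow hP
  have := hd.mono t ht
  have : Mono i := ⟨fun _ _ _ => toUnit_unique _ _⟩
  obtain ⟨(cl : S ⟶ U), (hcl₁ : i ≫ cl = b), (hcl₂ : j ≫ cl = b')⟩ :=
    BinaryCofan.IsColimit.desc' hc b b'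
  -- `d` is true on the first summand and false on the second, which makes the summands disjoint.
  obtain ⟨(d : S ⟶ Ω E), (hd₁ : i ≫ d = constTrue _), (hd₂ : j ≫ d = χ P.arrow)⟩ :=
    BinaryCofan.IsColimit.desc' hc (constTrue (𝟙_ E)) (χ P.arrow)
  have htrue : χ (𝟙 (𝟙_ E)) = constTrue (𝟙_ E) := by
    simpa using (comp_χ_eq_constTrue_iff (𝟙 (𝟙_ E)) (𝟙 (𝟙_ E))).2 ⟨𝟙 _, by simp⟩
  let m := pullback.snd t cl
  have hm : IsPullback (pullback.fst t cl) m t cl := IsPullback.of_hasPullback t cl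
  have hmC : Cof m := hd.of_isPullback hm ht
  have hχ : χ m = χ i := by
    rw [← comp_χ_of_isPullback hm]
    refine BinaryCofan.IsColimit.hom_ext hc ?_ ?_
    · change i ≫ cl ≫ χ t = i ≫ χ i
      rw [reassoc_of% hcl₁, comp_χ_of_isPullback hab, htrue,
        (comp_χ_eq_constTrue_iff i i).2 ⟨𝟙 _, by simp⟩]
    · change j ≫ cl ≫ χ t = j ≫ χ i
      rw [reassoc_of% hcl₂, comp_χ_of_isPullback hab']
      refine (eq_χ_of_forall_iff _ _ fun {_} x => ?_).symm
      rw [← Category.assoc, comp_χ_eq_constTrue_iff]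
      constructor
      · rintro ⟨y, hy⟩
        rw [← comp_χ_eq_constTrue_iff, ← hd₂, ← Category.assoc, ← hy, Category.assoc, hd₁,
          comp_constTrue]
      · rintro ⟨y, rfl⟩
        exact ⟨y ≫ P.arrow, by
          rw [Category.assoc, Category.assoc, hom_ext_of_isBot hbot (P.arrow ≫ i)]⟩
  obtain ⟨y, hy⟩ := (comp_χ_eq_constTrue_iff m i).1
    (by rw [hχ, comp_χ_eq_constTrue_iff]; exact ⟨𝟙 _, Category.id_comp _⟩)
  obtain ⟨z, hz⟩ := (comp_χ_eq_constTrue_iff i m).1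
    (by rw [← hχ, comp_χ_eq_constTrue_iff]; exact ⟨𝟙 _, by simp⟩)
  have : IsIso y := ⟨z, toUnit_unique _ _,
    by rw [← cancel_mono m, Category.assoc, hy, hz, Category.id_comp]⟩
  rw [← hy]
  exact hd.comp _ _ (hd.of_isIso _ this) hmC

lemma inl (hCof : IsCofibrationClass 𝕀 Cof) : Cof 𝕀.two.inl :=
  hCof.of_isColimit_inl (j := 𝕀.two.inr)
    (𝕀.isColimitTwo.ofIsoColimit (isoBinaryCofanMk 𝕀.two))

lemma inr (hCof : IsCofibrationClass 𝕀 Cof) : Cof 𝕀.two.inr :=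
  hCof.of_isColimit_inl (j := 𝕀.two.inl) (BinaryCofan.isColimitFlip 𝕀.isColimitTwo)

lemma zero (hCof : IsCofibrationClass 𝕀 Cof) : Cof 𝕀.zero :=
  hCof.isDominance.comp _ _ hCof.inl hCof.endpoints

lemma one (hCof : IsCofibrationClass 𝕀 Cof) : Cof 𝕀.one :=
  hCof.isDominance.comp _ _ hCof.inr hCof.endpoints

variable [MonoidalClosed E]

/-- The least upper bound provided by the union axiom is effective, so it computes the pushout over
the intersection. -/
lemma exists_isPushout (hCof : IsCofibrationClass 𝕀 Cof) {D P Q Z : E} {d₁ : D ⟶ P} {d₂ : D ⟶ Q}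
    {m : P ⟶ Z} {n : Q ⟶ Z} (h : IsPullback d₁ d₂ m n) (hm : Cof m) (hn : Cof n) :
    ∃ (R : E) (r : R ⟶ Z) (p : P ⟶ R) (q : Q ⟶ R), Cof r ∧ p ≫ r = m ∧ q ≫ r = n ∧
      IsPushout d₁ d₂ p q := by
  have hd := hCof.isDominance
  have := hd.mono m hm
  have := hd.mono n hn
  have hmk {A : E} (i : A ⟶ Z) [Mono i] (hi : Cof i) : Cof (Subobject.mk i).arrow := by
    rw [← Subobject.underlyingIso_hom_comp_eq_mk]
    exact hd.comp _ _ (hd.of_isIso _ inferInstance) hi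
  obtain ⟨R, hR, hlub⟩ := hCof.binary_union (Subobject.mk m) (Subobject.mk n) (hmk m hm) (hmk n hn)
  have hp := hlub.1 (Set.mem_insert _ _)
  have hq := hlub.1 (Set.mem_insert_of_mem _ (Set.mem_singleton _))
  have hpR : Subobject.ofMkLE m R hp ≫ R.arrow = m := Subobject.ofMkLE_arrow hp
  have hqR : Subobject.ofMkLE n R hq ≫ R.arrow = n := Subobject.ofMkLE_arrow hq
  have := mono_of_mono_fac hpR
  have := mono_of_mono_fac hqR
  refine ⟨R, R.arrow, _, _, hR, hpR, hqR, isPushout_of_cover ?_ ?_⟩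
  · rwa [← isPullback_comp_mono_iff R.arrow, hpR, hqR]
  · rintro N i _ ⟨a, ha⟩ ⟨b, hb⟩
    -- Viewed in `Z`, a subobject of `R` containing `P` and `Q` is an upper bound of both.
    have hle : R ≤ Subobject.mk (i ≫ R.arrow) := by
      refine hlub.2 ?_
      rintro S (rfl | rfl)
      · exact Subobject.mk_le_mk_of_comm a (by rw [reassoc_of% ha, hpR])
      · exact Subobject.mk_le_mk_of_comm b (by rw [reassoc_of% hb, hqR])
    have hs : Subobject.ofLEMk R _ hle ≫ i = 𝟙 _ := by
      rw [← cancel_mono R.arrow, Category.assoc, Subobject.ofLEMk_comp, Category.id_comp]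
    exact ⟨_, by rw [← cancel_mono i, Category.assoc, hs, Category.comp_id, Category.id_comp], hs⟩

/-- Pushout products of an endpoint with a cofibration exist, and they are cofibrations. -/
lemma exists_pushoutObjObj (hCof : IsCofibrationClass 𝕀 Cof) {e : 𝟙_ E ⟶ 𝕀.I} (he : Cof e)
    {X Y : E} {u : X ⟶ Y} (hu : Cof u) :
    ∃ sq : (curriedTensor E).PushoutObjObj e u, Cof sq.ι := by
  have hd := hCof.isDominance
  obtain ⟨R, r, p, q, hr, hp, hq, h⟩ := hCof.exists_isPushout
    (isPullback_whiskerRight_whiskerLeft e u)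
    (hd.of_isPullback (isPullback_whiskerLeft_snd 𝕀.I u) hu)
    (hd.of_isPullback (isPullback_whiskerRight_fst Y e) he)
  exact ⟨{ pt := R, inl := p, inr := q, isPushout := h, ι := r, inl_ι := hp, inr_ι := hq }, hr⟩

/-- Any two choices of the pushout are isomorphic over `I × Y`. -/
lemma pushoutObjObj_ι (hCof : IsCofibrationClass 𝕀 Cof) {e : 𝟙_ E ⟶ 𝕀.I} (he : Cof e)
    {X Y : E} {u : X ⟶ Y} (hu : Cof u) (sq : (curriedTensor E).PushoutObjObj e u) : Cof sq.ι := by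
  obtain ⟨sq', hsq'⟩ := hCof.exists_pushoutObjObj he hu
  have : (sq.isPushout.isoIsPushout _ _ sq'.isPushout).hom ≫ sq'.ι = sq.ι := by
    refine sq.isPushout.hom_ext ?_ ?_ <;> simp
  rw [← this]
  exact hCof.isDominance.comp _ _ (hCof.isDominance.of_isIso _ inferInstance) hsq'

end IsCofibrationClass

end Cofibrations

/-! ### Transposing lifting problems. -/

/-- The right adjoint of pullback along `f` transfers right lifting properties. -/
lemma hasLiftingProperty_map_left {E : Type u} [Category.{v} E] [HasPullbacks E]
    {A B : E} {f : B ⟶ A} {Pi : Over B ⥤ Over A}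
    (adj : Over.pullback f ⊣ Pi) {J Z : E} (j : J ⟶ Z) {g g' : Over B} (h : g ⟶ g')
    (H : ∀ (z : Z ⟶ A) {J' : E} (j' : J' ⟶ pullback z f) (p' : J' ⟶ J),
      IsPullback p' j' j (pullback.fst z f) → HasLiftingProperty j' h.left) :
    HasLiftingProperty j (Pi.map h).left where
  sq_hasLift {a b} sq := by
    let z := b ≫ (Pi.obj g').hom
    have hz : a ≫ (Pi.obj g).hom = j ≫ z := by
      rw [← Over.w (Pi.map h), reassoc_of% sq.w]
    let jA : Over.mk (j ≫ z) ⟶ Over.mk z := Over.homMk j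
    have hpb : IsPullback (pullback.fst (j ≫ z) f) ((Over.pullback f).map jA).left j
        (pullback.fst z f) := by
      refine IsPullback.of_bot ?_ (pullback.lift_fst _ _ _).symm (IsPullback.of_hasPullback z f)
      have hsnd : ((Over.pullback f).map jA).left ≫ pullback.snd z f = pullback.snd (j ≫ z) f :=
        pullback.lift_snd _ _ _
      rw [hsnd]
      exact IsPullback.of_hasPullback (j ≫ z) f
    have := H z _ _ hpb
    -- A lift found in `E` lies over `B` automatically, because its lower triangle commutes.
    have hl : HasLiftingProperty ((Over.pullback f).map jA) h := ⟨fun {s t} st => by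
      have st' : CommSq s.left ((Over.pullback f).map jA).left h.left t.left :=
        ⟨congrArg CommaMorphism.left st.w⟩
      refine ⟨⟨⟨Over.homMk st'.lift ?_, ?_, ?_⟩⟩⟩
      · rw [← Over.w h, reassoc_of% st'.fac_right, Over.w t]
      · ext
        exact st'.fac_left
      · ext
        exact st'.fac_right⟩
    rw [adj.hasLiftingProperty_iff] at hl
    have st : CommSq (Over.homMk a hz : Over.mk (j ≫ z) ⟶ Pi.obj g) jA (Pi.map h)
        (Over.homMk b rfl : Over.mk z ⟶ Pi.obj g') := ⟨by ext; exact sq.w⟩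
    exact ⟨⟨⟨st.lift.left, congrArg CommaMorphism.left st.fac_left,
      congrArg CommaMorphism.left st.fac_right⟩⟩⟩

/-! ### Fibrations, connections and deformations. -/

section Fibrations

variable {E : Type u} [Category.{v} E] [CartesianMonoidalCategory E]

/-- The inclusion of `Y` into the cylinder `I ⊗ Y` at the endpoint `e`. -/
def inclAt {I : E} (e : 𝟙_ E ⟶ I) (Y : E) : Y ⟶ I ⊗ Y := lift (toUnit Y ≫ e) (𝟙 Y)

lemma whiskerRight_eq_snd_inclAt {I : E} (e : 𝟙_ E ⟶ I) (Y : E) :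
    e ▷ Y = snd _ _ ≫ inclAt e Y := by
  ext
  · simp only [whiskerRight_fst, inclAt, Category.assoc, lift_fst]
    rw [← Category.assoc]
    congr 1
    exact toUnit_unique _ _
  · simp [inclAt]

lemma inclAt_naturality {I : E} (e : 𝟙_ E ⟶ I) {X Y : E} (u : X ⟶ Y) :
    inclAt e X ≫ I ◁ u = u ≫ inclAt e Y := by
  ext
  · simp only [inclAt, Category.assoc, lift_whiskerLeft, lift_fst]
    rw [← Category.assoc]
    congr 1
    exact toUnit_unique _ _
  · simp [inclAt]

variable {𝕀 : IntervalObject E} {Cof : MorphismProperty E}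

/-- The lifting property of a fibration at one of the two endpoints. -/
def LiftsAt (e : 𝟙_ E ⟶ 𝕀.I) (Cof : MorphismProperty E) {C D : E} (p : C ⟶ D) : Prop :=
  ∀ {X Y : E} (u : X ⟶ Y), Cof u →
    ∀ sq : (curriedTensor E).PushoutObjObj e u, HasLiftingProperty sq.ι p

lemma isFib_iff {C D : E} (p : C ⟶ D) :
    IsFib 𝕀 Cof p ↔ LiftsAt 𝕀.zero Cof p ∧ LiftsAt 𝕀.one Cof p :=
  ⟨fun h => ⟨fun u hu => (h u hu).1, fun u hu => (h u hu).2⟩,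
    fun h _ _ u hu => ⟨h.1 u hu, h.2 u hu⟩⟩

lemma IsFib.comp {A B C : E} {p : A ⟶ B} {q : B ⟶ C} (hp : IsFib 𝕀 Cof p)
    (hq : IsFib 𝕀 Cof q) : IsFib 𝕀 Cof (p ≫ q) := by
  refine fun u hu => ⟨fun sq => ?_, fun sq => ?_⟩
  · have := (hp u hu).1 sq
    have := (hq u hu).1 sq
    infer_instance
  · have := (hp u hu).2 sq
    have := (hq u hu).2 sq
    infer_instance

lemma IsFib.of_isPullback {A B C D : E} {a : A ⟶ B} {p' : A ⟶ C} {p : B ⟶ D} {b : C ⟶ D}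
    (h : IsPullback a p' p b) (hp : IsFib 𝕀 Cof p) : IsFib 𝕀 Cof p' := by
  refine fun u hu => ⟨fun sq => ?_, fun sq => ?_⟩
  · have := (hp u hu).1 sq
    exact h.hasLiftingProperty _
  · have := (hp u hu).2 sq
    exact h.hasLiftingProperty _

/-- A connection on the interval which is absorbing at the endpoint `e` and for which the endpoint
`e'` is neutral on the left. -/
structure EndpointConnection (𝕀 : IntervalObject E) (e e' : 𝟙_ E ⟶ 𝕀.I) where
  /-- The binary operation. -/
  op : 𝕀.I ⊗ 𝕀.I ⟶ 𝕀.I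
  left_absorb {X : E} (i : X ⟶ 𝕀.I) : lift (toUnit X ≫ e) i ≫ op = toUnit X ≫ e
  right_absorb {X : E} (i : X ⟶ 𝕀.I) : lift i (toUnit X ≫ e) ≫ op = toUnit X ≫ e
  left_neutral {X : E} (i : X ⟶ 𝕀.I) : lift (toUnit X ≫ e') i ≫ op = i

/-- The connection `∧`, absorbing at `0`. -/
def IntervalObject.meetConnection (𝕀 : IntervalObject E) :
    EndpointConnection 𝕀 𝕀.zero 𝕀.one where
  op := 𝕀.meet
  left_absorb := 𝕀.zero_meet
  right_absorb := 𝕀.meet_zero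
  left_neutral := 𝕀.one_meet

/-- The connection `∨`, absorbing at `1`. -/
def IntervalObject.joinConnection (𝕀 : IntervalObject E) :
    EndpointConnection 𝕀 𝕀.one 𝕀.zero where
  op := 𝕀.join
  left_absorb := 𝕀.one_join
  right_absorb := 𝕀.join_one
  left_neutral := 𝕀.zero_join

/-- A deformation of `Z` into `J`: a homotopy on `Z` which starts at `e'` with the identity, ends
at `e` in `J`, and restricts to `J`. -/
structure Deformation {𝕀 : IntervalObject E} (e e' : 𝟙_ E ⟶ 𝕀.I) {J Z : E} (j : J ⟶ Z) where
  /-- The homotopy. -/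
  H : 𝕀.I ⊗ Z ⟶ Z
  /-- The retraction of `Z` into `J`. -/
  r : Z ⟶ J
  /-- The restriction of the homotopy to `J`. -/
  k : 𝕀.I ⊗ J ⟶ J
  inclAt_neutral : inclAt e' Z ≫ H = 𝟙 Z
  inclAt_absorb : inclAt e Z ≫ H = r ≫ j
  k_comp : k ≫ j = 𝕀.I ◁ j ≫ H

namespace EndpointConnection

variable {e e' : 𝟙_ E ⟶ 𝕀.I} (c : EndpointConnection 𝕀 e e')

/-- The contraction of the cylinder `I ⊗ Y` onto its end `e`. -/
def contraction (Y : E) : 𝕀.I ⊗ (𝕀.I ⊗ Y) ⟶ 𝕀.I ⊗ Y :=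
  lift (lift (fst _ _) (snd _ _ ≫ fst _ _) ≫ c.op) (snd _ _ ≫ snd _ _)

lemma contraction_naturality {X Y : E} (u : X ⟶ Y) :
    𝕀.I ◁ (𝕀.I ◁ u) ≫ c.contraction Y = c.contraction X ≫ 𝕀.I ◁ u := by
  ext
  · simp only [contraction, Category.assoc, whiskerLeft_fst, lift_fst, comp_lift_assoc]
    simp
  · simp [contraction]

lemma inclAt_neutral_contraction (Y : E) : inclAt e' (𝕀.I ⊗ Y) ≫ c.contraction Y = 𝟙 _ := by
  ext
  · simp only [contraction, inclAt, Category.assoc, lift_fst, comp_lift_assoc, lift_snd_assoc,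
      Category.id_comp, c.left_neutral]
  · simp [contraction, inclAt]

lemma inclAt_absorb_contraction (Y : E) :
    inclAt e (𝕀.I ⊗ Y) ≫ c.contraction Y = snd _ _ ≫ inclAt e Y := by
  ext
  · simp only [contraction, inclAt, Category.assoc, lift_fst, comp_lift_assoc, lift_snd_assoc,
      Category.id_comp, c.left_absorb]
    rw [← Category.assoc]
    congr 1
    exact toUnit_unique _ _
  · simp [contraction, inclAt]

lemma whiskerLeft_inclAt_contraction (Y : E) :
    𝕀.I ◁ inclAt e Y ≫ c.contraction Y = snd _ _ ≫ inclAt e Y := by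
  have h : snd 𝕀.I Y ≫ toUnit Y ≫ e = toUnit _ ≫ e := by
    rw [← Category.assoc]
    congr 1
    exact toUnit_unique _ _
  ext
  · simp only [contraction, inclAt, Category.assoc, lift_fst, comp_lift_assoc, whiskerLeft_fst,
      whiskerLeft_snd_assoc, h, c.right_absorb]
  · simp [contraction, inclAt]

variable [MonoidalClosed E]

/-- Neutrality of `e'` gives the identity, left absorption puts the other end inside `e × Y`, and
right absorption keeps `e × Y` fixed during the homotopy. -/
lemma exists_deformation (c : EndpointConnection 𝕀 e e') {X Y : E} {u : X ⟶ Y}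
    (sq : (curriedTensor E).PushoutObjObj e u) :
    Nonempty (Deformation e e' sq.ι) := by
  have hsq : (e ▷ X) ≫ sq.inl = (𝟙_ E ◁ u) ≫ sq.inr := sq.isPushout.w
  have hinl : sq.inl ≫ sq.ι = 𝕀.I ◁ u := sq.inl_ι
  have hinr : sq.inr ≫ sq.ι = e ▷ Y := sq.inr_ι
  have hw : (e ▷ X) ≫ MonoidalClosed.curry (c.contraction X ≫ sq.inl) =
      (𝟙_ E ◁ u) ≫ MonoidalClosed.curry (snd 𝕀.I (𝟙_ E ⊗ Y) ≫ sq.inr) := by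
    rw [← MonoidalClosed.curry_natural_left, ← MonoidalClosed.curry_natural_left,
      whiskerLeft_snd_assoc, ← hsq, whiskerRight_eq_snd_inclAt, MonoidalCategory.whiskerLeft_comp,
      Category.assoc, reassoc_of% c.whiskerLeft_inclAt_contraction X]
    simp
  -- Currying lets a map out of `I ⊗ sq.pt` be defined by gluing: the contraction on `I ⊗ X`, the
  -- constant homotopy on the end.
  let k' := sq.isPushout.desc _ _ hw
  have hk₁ : sq.inl ≫ k' = _ := sq.isPushout.inl_desc _ _ hw
  have hk₂ : sq.inr ≫ k' = _ := sq.isPushout.inr_desc _ _ hw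
  refine ⟨⟨c.contraction Y, snd _ _ ≫ (λ_ Y).inv ≫ sq.inr, MonoidalClosed.uncurry k',
    c.inclAt_neutral_contraction Y, ?_, ?_⟩⟩
  · refine (c.inclAt_absorb_contraction Y).trans ?_
    rw [Category.assoc, Category.assoc, hinr, whiskerRight_eq_snd_inclAt]
    simp
  · apply MonoidalClosed.curry_injective
    rw [MonoidalClosed.curry_natural_right, MonoidalClosed.curry_uncurry]
    refine sq.isPushout.hom_ext ?_ ?_
    · rw [reassoc_of% hk₁, ← MonoidalClosed.curry_natural_right,
        ← MonoidalClosed.curry_natural_left]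
      congr 1
      rw [Category.assoc, hinl, ← MonoidalCategory.whiskerLeft_comp_assoc, hinl,
        c.contraction_naturality]
    · rw [reassoc_of% hk₂, ← MonoidalClosed.curry_natural_right,
        ← MonoidalClosed.curry_natural_left]
      congr 1
      rw [Category.assoc, hinr, ← MonoidalCategory.whiskerLeft_comp_assoc, hinr,
        whiskerRight_eq_snd_inclAt, MonoidalCategory.whiskerLeft_comp, Category.assoc,
        c.whiskerLeft_inclAt_contraction]
      simp

end EndpointConnection

/-! ### Box filling and the Frobenius property. -/

variable [HasFiniteLimits E] [HasSubobjectClassifier E] [MonoidalClosed E]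

/-- Box filling: partial lifts over the union of a cylinder on a cofibration and an end of a
cylinder extend along fibrations. -/
lemma LiftsAt.exists_lift (hCof : IsCofibrationClass 𝕀 Cof) {e : 𝟙_ E ⟶ 𝕀.I} (he : Cof e)
    {C D : E} {p : C ⟶ D} (hp : LiftsAt e Cof p) {X Y : E} {u : X ⟶ Y} (hu : Cof u)
    (a : 𝕀.I ⊗ X ⟶ C) (b : Y ⟶ C) (d : 𝕀.I ⊗ Y ⟶ D) (hab : inclAt e X ≫ a = u ≫ b)
    (had : a ≫ p = 𝕀.I ◁ u ≫ d) (hbd : b ≫ p = inclAt e Y ≫ d) :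
    ∃ l : 𝕀.I ⊗ Y ⟶ C, 𝕀.I ◁ u ≫ l = a ∧ inclAt e Y ≫ l = b ∧ l ≫ p = d := by
  obtain ⟨sq, -⟩ := hCof.exists_pushoutObjObj he hu
  have hinl : sq.inl ≫ sq.ι = 𝕀.I ◁ u := sq.inl_ι
  have hinr : sq.inr ≫ sq.ι = e ▷ Y := sq.inr_ι
  have := hp u hu sq
  have hw : (e ▷ X) ≫ a = (𝟙_ E ◁ u) ≫ snd _ _ ≫ b := by
    rw [whiskerRight_eq_snd_inclAt, Category.assoc, hab, whiskerLeft_snd_assoc]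
  let f := sq.isPushout.desc a (snd _ _ ≫ b) hw
  have hf₁ : sq.inl ≫ f = a := sq.isPushout.inl_desc _ _ hw
  have hf₂ : sq.inr ≫ f = snd _ _ ≫ b := sq.isPushout.inr_desc _ _ hw
  have hf : CommSq f sq.ι p d := ⟨sq.isPushout.hom_ext
    (by rw [reassoc_of% hf₁, reassoc_of% hinl, had])
    (by rw [reassoc_of% hf₂, reassoc_of% hinr, hbd, whiskerRight_eq_snd_inclAt, Category.assoc])⟩
  refine ⟨hf.lift, ?_, ?_, hf.fac_right⟩
  · rw [← hinl, Category.assoc, hf.fac_left, hf₁]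
  · have h : snd (𝟙_ E) Y ≫ inclAt e Y ≫ hf.lift = snd _ _ ≫ b := by
      rw [← Category.assoc, ← whiskerRight_eq_snd_inclAt, ← hinr, Category.assoc, hf.fac_left, hf₂]
    simpa using (λ_ Y).inv ≫= h

namespace Deformation

variable {e e' : 𝟙_ E ⟶ 𝕀.I} {J Z : E} {j : J ⟶ Z}

/-- Fill the box over `δ.H ≫ g` with side `δ.k ≫ f` and end `δ.r ≫ f` at `e`; at `e'` the homotopy
is the identity, so the filler there solves the original square. -/
lemma hasLiftingProperty (hCof : IsCofibrationClass 𝕀 Cof) (he : Cof e) (hj : Cof j)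
    (δ : Deformation e e' j) {C D : E} {q : C ⟶ D} (hq : LiftsAt e Cof q) :
    HasLiftingProperty j q where
  sq_hasLift {f g} sq := by
    have := hCof.isDominance.mono j hj
    have hr : inclAt e J ≫ δ.k = j ≫ δ.r := by
      rw [← cancel_mono j, Category.assoc, δ.k_comp, Category.assoc, ← δ.inclAt_absorb,
        ← Category.assoc, inclAt_naturality, Category.assoc]
    obtain ⟨l, hl₁, -, hl₃⟩ := hq.exists_lift hCof he hj (δ.k ≫ f) (δ.r ≫ f) (δ.H ≫ g)
      (by rw [reassoc_of% hr])
      (by rw [Category.assoc, sq.w, reassoc_of% δ.k_comp])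
      (by rw [Category.assoc, sq.w, ← Category.assoc, ← δ.inclAt_absorb, Category.assoc])
    refine ⟨⟨⟨inclAt e' Z ≫ l, ?_, ?_⟩⟩⟩
    · have : inclAt e' J ≫ δ.k = 𝟙 J := by
        rw [← cancel_mono j, Category.assoc, δ.k_comp, ← Category.assoc, inclAt_naturality,
          Category.assoc, δ.inclAt_neutral, Category.comp_id, Category.id_comp]
      rw [← Category.assoc, ← inclAt_naturality, Category.assoc, hl₁, reassoc_of% this]
    · rw [Category.assoc, hl₃, ← Category.assoc, δ.inclAt_neutral, Category.id_comp]

/-- A deformation lifts along a fibration, by path lifting. -/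
lemma exists_of_isPullback (hCof : IsCofibrationClass 𝕀 Cof) (he' : Cof e')
    (δ : Deformation e e' j) {B J' : E} {p : B ⟶ Z} (hp : LiftsAt e' Cof p) {j' : J' ⟶ B}
    {p' : J' ⟶ J} (h : IsPullback p' j' j p) : Nonempty (Deformation e e' j') := by
  -- Path lifting is box filling for the empty cofibration `P ⟶ B`; by currying, maps out of `I ⊗ P`
  -- are unique as well.
  obtain ⟨P, hP, hbot⟩ := hCof.empty_union B
  obtain ⟨K, -, hK₂, hK₃⟩ := hp.exists_lift hCof he' hP (snd _ _ ≫ P.arrow) (𝟙 B)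
    (𝕀.I ◁ p ≫ δ.H) (hom_ext_of_isBot hbot _ _)
    (MonoidalClosed.curry_injective (hom_ext_of_isBot hbot _ _))
    (by rw [Category.id_comp, ← Category.assoc, inclAt_naturality, Category.assoc,
      δ.inclAt_neutral, Category.comp_id])
  have hr : (p ≫ δ.r) ≫ j = (inclAt e B ≫ K) ≫ p := by
    rw [Category.assoc, Category.assoc, hK₃, ← Category.assoc (inclAt e B), inclAt_naturality,
      Category.assoc, δ.inclAt_absorb]
  have hk : (𝕀.I ◁ p' ≫ δ.k) ≫ j = (𝕀.I ◁ j' ≫ K) ≫ p := by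
    rw [Category.assoc, Category.assoc, hK₃, δ.k_comp, ← MonoidalCategory.whiskerLeft_comp_assoc,
      h.w, MonoidalCategory.whiskerLeft_comp_assoc]
  exact ⟨⟨K, h.lift _ _ hr, h.lift _ _ hk, hK₂, (h.lift_snd _ _ _).symm, h.lift_snd _ _ _⟩⟩

end Deformation

/-- The Frobenius property at an endpoint: the pullback of a pushout product along a fibration has
the left lifting property against fibrations. -/
lemma EndpointConnection.hasLiftingProperty_of_isPullback (hCof : IsCofibrationClass 𝕀 Cof)
    {e e' : 𝟙_ E ⟶ 𝕀.I} (c : EndpointConnection 𝕀 e e') (he : Cof e) (he' : Cof e') {X Y : E}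
    {u : X ⟶ Y} (hu : Cof u) (sq : (curriedTensor E).PushoutObjObj e u) {B J' : E}
    {p : B ⟶ 𝕀.I ⊗ Y} (hp : LiftsAt e' Cof p) {j' : J' ⟶ B} {p' : J' ⟶ sq.pt}
    (h : IsPullback p' j' sq.ι p) {C D : E} {q : C ⟶ D} (hq : LiftsAt e Cof q) :
    HasLiftingProperty j' q := by
  obtain ⟨δ⟩ := c.exists_deformation sq
  obtain ⟨δ'⟩ := δ.exists_of_isPullback hCof he' hp h
  exact δ'.hasLiftingProperty hCof he
    (hCof.isDominance.of_isPullback h (hCof.pushoutObjObj_ι he hu sq)) hq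

/-- The two endpoints trade roles: lifting for `Π_f(h)` at one end uses `h` at that end and `f` at
the opposite one. -/
lemma IsFib.map_left (hCof : IsCofibrationClass 𝕀 Cof) {A B : E} {f : B ⟶ A}
    (hf : IsFib 𝕀 Cof f) {Pi : Over B ⥤ Over A} (adj : Over.pullback f ⊣ Pi) {g g' : Over B}
    (h : g ⟶ g') (hh : IsFib 𝕀 Cof h.left) : IsFib 𝕀 Cof (Pi.map h).left := by
  have hf' {Z : E} (z : Z ⟶ A) : IsFib 𝕀 Cof (pullback.fst z f) :=
    hf.of_isPullback (IsPullback.of_hasPullback z f).flip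
  rw [isFib_iff] at hh ⊢
  exact ⟨fun u hu sq => hasLiftingProperty_map_left adj _ h fun z _ _ _ hpb =>
      𝕀.meetConnection.hasLiftingProperty_of_isPullback hCof hCof.zero hCof.one hu sq
        ((isFib_iff _).1 (hf' z)).2 hpb hh.1,
    fun u hu sq => hasLiftingProperty_map_left adj _ h fun z _ _ _ hpb =>
      𝕀.joinConnection.hasLiftingProperty_of_isPullback hCof hCof.one hCof.zero hu sq
        ((isFib_iff _).1 (hf' z)).1 hpb hh.2⟩

/-- Regard `g` as a map to the terminal object of `E/B`; `Π_f` preserves terminal objects, so this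
reduces to the case of morphisms up to an isomorphism over `A`. -/
lemma IsFib.obj_hom (hCof : IsCofibrationClass 𝕀 Cof) {A B : E} {f : B ⟶ A}
    (hf : IsFib 𝕀 Cof f) {Pi : Over B ⥤ Over A} (adj : Over.pullback f ⊣ Pi) (g : Over B)
    (hg : IsFib 𝕀 Cof g.hom) : IsFib 𝕀 Cof (Pi.obj g).hom := by
  have hT : IsTerminal (Pi.obj (Over.mk (𝟙 B))) := by
    have := adj.rightAdjoint_preservesLimits
    exact Over.mkIdTerminal.isTerminalObj Pi _
  have : IsIso (Pi.obj (Over.mk (𝟙 B))).hom := by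
    have h := Over.w (hT.uniqueUpToIso Over.mkIdTerminal).hom
    have : IsIso (hT.uniqueUpToIso Over.mkIdTerminal).hom.left :=
      inferInstanceAs (IsIso ((Over.forget A).map (hT.uniqueUpToIso Over.mkIdTerminal).hom))
    rw [← h]
    exact IsIso.comp_isIso' this (inferInstanceAs (IsIso (𝟙 A)))
  let t : g ⟶ Over.mk (𝟙 B) := Over.homMk g.hom
  have ht : IsFib 𝕀 Cof (Pi.map t).left := hf.map_left hCof adj t hg
  have hiso : IsFib 𝕀 Cof (Pi.obj (Over.mk (𝟙 B))).hom :=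
    fun _ _ => ⟨fun _ => inferInstance, fun _ => inferInstance⟩
  have h : IsFib 𝕀 Cof ((Pi.map t).left ≫ (Pi.obj (Over.mk (𝟙 B))).hom) := IsFib.comp ht hiso
  rwa [Over.w] at h

end Fibrations

theorem mainTheorem2 {E : Type u} [Category.{v} E] [HasFiniteLimits E]
    [CartesianMonoidalCategory E] [MonoidalClosed E] [HasSubobjectClassifier E]
    (𝕀 : IntervalObject E) (Cof : MorphismProperty E) (hCof : IsCofibrationClass 𝕀 Cof)
    {A B : E} (f : B ⟶ A) (hf : IsFib 𝕀 Cof f) :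
    -- the right adjoint `Π_f` exists
    (∃ Pi : Over B ⥤ Over A, Nonempty (Over.pullback f ⊣ Pi)) ∧
    ∀ (Pi : Over B ⥤ Over A), (Over.pullback f ⊣ Pi) →
      -- `Π_f` preserves fibrations, both as objects over `B` and as maps of `E/B`
      (∀ g : Over B, IsFib 𝕀 Cof g.hom → IsFib 𝕀 Cof (Pi.obj g).hom) ∧
      (∀ {g g' : Over B} (h : g ⟶ g'), IsFib 𝕀 Cof h.left → IsFib 𝕀 Cof (Pi.map h).left) ∧
      -- `f^* ⊣ Π_f` restricts to the full subcategories `(E/A)_f` and `(E/B)_f`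
      (∃ (hpb : ∀ X : Over A, IsFib 𝕀 Cof X.hom → IsFib 𝕀 Cof ((Over.pullback f).obj X).hom)
        (hPi : ∀ g : Over B, IsFib 𝕀 Cof g.hom → IsFib 𝕀 Cof (Pi.obj g).hom),
        Nonempty (restrictFib 𝕀 Cof (Over.pullback f) hpb ⊣ restrictFib 𝕀 Cof Pi hPi)) ∧
      -- over a fibrant base, `Π_f` of a fibration lies in `E_f`
      (IsFibrantObj 𝕀 Cof A → ∀ g : Over B, IsFib 𝕀 Cof g.hom →
        IsFibrantObj 𝕀 Cof (Pi.obj g).left) := by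
  refine ⟨(isLeftAdjoint_overPullback f).exists_rightAdjoint, fun Pi adj =>
    ⟨hf.obj_hom hCof adj, fun h hh => hf.map_left hCof adj h hh,
      ⟨fun X hX => hX.of_isPullback (IsPullback.of_hasPullback X.hom f), hf.obj_hom hCof adj,
        ⟨adj.restrictFullyFaithful (fibrationsOver 𝕀 Cof A).fullyFaithfulι
          (fibrationsOver 𝕀 Cof B).fullyFaithfulι (Iso.refl _) (Iso.refl _)⟩⟩, fun hA g hg => ?_⟩⟩
  rw [IsFibrantObj, toUnit_unique (toUnit _) ((Pi.obj g).hom ≫ toUnit A)]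
  exact IsFib.comp (hf.obj_hom hCof adj g hg) hA
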